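/- Let $d\ge 2$ and $k\ge 1$ be integers, put $j=2d+k-3$, and let $$T=(1,2,\dots,d-1,\underbrace{d,\dots,d}_{k},d-1,\dots,2,1)$$ (in degrees $0,1,\dots,j$). Let $\mathsf k$ be an infinite field whose characteristic is $0$ or greater than $j$. Let $P$ be a partition having diagonal lengths $T$, that is, for every $i\ge 0$ the number of boxes of the Ferrers diagram of $P$ whose row index and column index (both counted from $0$) add up to $i$ is $T_i$ (with $T_i=0$ for $i>j$). Then the following are equivalent. 1. $P$ is the Jordan type of a linear form for some complete intersection algebra of Hilbert function $T$: there are an ideal $I\subset R=\mathsf k[x,y]$ generated by a regular sequence of two homogeneous polynomials, with $A=R/I$ of finite dimension over $\mathsf k$ and $\dim_{\mathsf k}A_i=T_i$ for all $i\ge 0$, and a linear form $\ell\in A_1$, such that the Jordan blocks of the (nilpotent) multiplication map $m_\ell:A\to A$, $a\mapsto \ell a$, have as sizes exactly the parts of $P$. 2. $P$ has exactly $d$ parts (the weak Lefschetz case) or exactly $d+k-1$ parts. -/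

import Mathlib

/-- The Hilbert function `T = (1, 2, …, d - 1, d, …, d, d - 1, …, 2, 1)` in which the value `d` is
repeated `k` times (for `d, k ≥ 1`), as a function of the degree: it is `i + 1` for `i ≤ d - 1`,
then `d` for `d - 1 ≤ i ≤ d + k - 2`, then `j + 1 - i` for `d + k - 2 ≤ i ≤ j = 2d + k - 3`,
and `0` in degrees above `j`. -/
def ciHilbertFunction (d k i : ℕ) : ℕ :=
  min (i + 1) (min d (2 * d + k - 2 - i))

/-- The number of boxes on the `i`-th lower-left to upper-right diagonal of a Ferrers diagram.
A partition `p₁ ≥ p₂ ≥ …` is represented by its Ferrers diagram, with the box in row `r` and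
column `c` (both counted from `0`) written `(r, c)`; so the rows are the parts. -/
def diagonalLength (P : YoungDiagram) (i : ℕ) : ℕ :=
  (P.cells.filter fun c => c.1 + c.2 = i).card

/-- The number of parts of a partition. -/
def numParts (P : YoungDiagram) : ℕ :=
  P.rowLens.length

/-- `P` is the Jordan type of the nilpotent endomorphism `φ`: there is a basis of `V`, indexed by
the boxes of `P`, such that `φ` moves the basis vector of a box to the basis vector of the next box
in the same row, and kills the last one of each row. So each row, of length `p`, spans a single
nilpotent Jordan block of size `p`. -/
def IsJordanType {K V : Type*} [Field K] [AddCommGroup V] [Module K V]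
    (φ : V →ₗ[K] V) (P : YoungDiagram) : Prop :=
  ∃ b : Module.Basis {c : ℕ × ℕ // c ∈ P.cells} K V,
    ∀ (r c : ℕ) (h : (r, c) ∈ P.cells),
      φ (b ⟨(r, c), h⟩) =
        if h' : (r, c + 1) ∈ P.cells then b ⟨(r, c + 1), h'⟩ else 0

/-- `K[x,y]/I` is a graded Artinian complete intersection: it has finite dimension over `K`, and
`I` is generated by a regular sequence of two homogeneous polynomials. -/
def IsGradedArtinianCI {K : Type*} [Field K] (I : Ideal (MvPolynomial (Fin 2) K)) : Prop :=
  Module.Finite K (MvPolynomial (Fin 2) K ⧸ I) ∧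
    ∃ (f g : MvPolynomial (Fin 2) K) (a b : ℕ),
      f.IsHomogeneous a ∧ g.IsHomogeneous b ∧
      RingTheory.Sequence.IsRegular (MvPolynomial (Fin 2) K) [f, g] ∧
      I = Ideal.span {f, g}

/-- The Hilbert function of `A = K[x,y]/I`, for `I` homogeneous: the dimension of the degree `i`
component `A_i`, the image in `A` of the space of forms of degree `i`. -/
noncomputable def hilbertFunction {K : Type*} [Field K] (I : Ideal (MvPolynomial (Fin 2) K))
    (i : ℕ) : ℕ :=
  Module.finrank K
    ((MvPolynomial.homogeneousSubmodule (Fin 2) K i).map (Ideal.Quotient.mkₐ K I).toLinearMap)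

/-- `P` occurs as the Jordan type of multiplication by a linear form on some graded Artinian
complete intersection quotient of `K[x,y]` with Hilbert function `T`. -/
def IsCIJordanType (K : Type*) [Field K] (T : ℕ → ℕ) (P : YoungDiagram) : Prop :=
  ∃ I : Ideal (MvPolynomial (Fin 2) K), IsGradedArtinianCI I ∧ (∀ i, hilbertFunction I i = T i) ∧
    ∃ l : MvPolynomial (Fin 2) K, l.IsHomogeneous 1 ∧
      IsJordanType (LinearMap.mulLeft K (Ideal.Quotient.mk I l)) P

/-! The number of Jordan blocks of `ℓ` is the dimension of `A/ℓA`. Restricting to the line `ℓ = 0`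
turns this into a quotient of `K[t]` by the restrictions of the two generators, which are monomials
`u t^a` and `v t^b`; its dimension is therefore `a` or `b`. The Hilbert function forces `{a, b} =
{d, d + k - 1}` (`degrees_eq_of_hilbertFunction`, `numParts_of_isCIJordanType`).

Conversely, let `P` have `n` rows, of lengths `p_r`, with `n` one of the two values. Then the last
boxes of the rows lie in `n` consecutive degrees, one row per degree
(`rowsEndOnceFrom_of_diagonalLength`). Take forms `e_r` congruent to `y^r` modulo `x`, so that the
`x^c e_r` form a basis of `K[x,y]`. In the recursion for `e_{r+1}`, a correction term is added when
some earlier row `σ r` ends one degree after row `r`. The boxes outside `P` then span an ideal `I`,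
the boxes of `P` give a basis of the quotient, and `x` shifts each row, so its Jordan type is `P`.
The corrections make `I` generated by two elements: `e_n` and the first missing box of the row that
ends earliest. Multiplying by `y` passes from the end of each row to the end of the row ending one
degree later (`span_pair_eq_span_stringFamily`). -/

open MvPolynomial in
/-- Forms `e_r` of degree `r`, with `e_0 = 1` and `e_{r+1} = y e_r + x ^ (r + 1 - σ r) e_{σ r}`, where
the last term is present only if `σ r ≤ r`. -/
noncomputable def stringGen (K : Type*) [Field K] (σ : ℕ → ℕ) : ℕ → MvPolynomial (Fin 2) K
  | 0 => 1
  | r + 1 => X 1 * stringGen K σ r +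
      if _h : σ r ≤ r then X 0 ^ (r + 1 - σ r) * stringGen K σ (σ r) else 0

open MvPolynomial in
/-- The family `x ^ c * e_r`, indexed by the boxes `(r, c)` of the quarter plane. -/
noncomputable def stringFamily (K : Type*) [Field K] (σ : ℕ → ℕ) (b : ℕ × ℕ) :
    MvPolynomial (Fin 2) K :=
  X 0 ^ b.2 * stringGen K σ b.1

/-! ### The basis `x^c e_r` of the polynomial ring. -/

section Strings

open MvPolynomial

variable {K : Type*} [Field K] (σ : ℕ → ℕ)

theorem stringGen_isHomogeneous (r : ℕ) : (stringGen K σ r).IsHomogeneous r := by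
  induction r using Nat.strong_induction_on with
  | _ r ih =>
    cases r with
    | zero => rw [stringGen]; exact isHomogeneous_one _ _
    | succ r =>
      rw [stringGen]
      refine IsHomogeneous.add ?_ ?_
      · rw [add_comm r 1]
        exact (isHomogeneous_X _ _).mul (ih r (by omega))
      · split_ifs with h
        · have h1 := (isHomogeneous_X_pow (R := K) (0 : Fin 2) (r + 1 - σ r)).mul
            (ih (σ r) (by omega))
          rwa [show r + 1 - σ r + σ r = r + 1 by omega] at h1
        · exact isHomogeneous_zero _ _ _

theorem stringGen_eq_pow_add (r : ℕ) :
    ∃ u, stringGen K σ r = X 1 ^ r + X 0 * u := by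
  induction r with
  | zero => exact ⟨0, by rw [stringGen]; simp⟩
  | succ r ih =>
    obtain ⟨u, hu⟩ := ih
    rw [stringGen, hu]
    split_ifs with h
    · refine ⟨X 1 * u + X 0 ^ (r - σ r) * stringGen K σ (σ r), ?_⟩
      rw [show r + 1 - σ r = r - σ r + 1 by omega]
      ring
    · exact ⟨X 1 * u, by ring⟩

theorem stringFamily_isHomogeneous (b : ℕ × ℕ) :
    (stringFamily K σ b).IsHomogeneous (b.1 + b.2) := by
  rw [add_comm]
  exact (isHomogeneous_X_pow _ _).mul (stringGen_isHomogeneous σ _)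

theorem X_zero_mul_stringFamily (r c : ℕ) :
    X 0 * stringFamily K σ (r, c) = stringFamily K σ (r, c + 1) := by
  simp only [stringFamily]; ring

theorem X_one_mul_stringFamily (r c : ℕ) :
    X 1 * stringFamily K σ (r, c) = stringFamily K σ (r + 1, c) -
      if σ r ≤ r then stringFamily K σ (σ r, c + (r + 1 - σ r)) else 0 := by
  simp only [stringFamily]
  rw [stringGen]
  split_ifs <;> ring

/-- Modulo `x` the form `e_r` is `y^r`, so the lowest power of `x` in `x^c' e_r` comes with `y^r`
alone. This triangularity gives linear independence. -/
theorem coeff_stringFamily (r s c c' : ℕ) (h : c ≤ c') :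
    coeff (Finsupp.single 0 c + Finsupp.single 1 s) (stringFamily K σ (r, c')) =
      if c = c' ∧ s = r then 1 else 0 := by
  obtain ⟨u, hu⟩ := stringGen_eq_pow_add (K := K) σ r
  simp only [stringFamily, hu, X_pow_eq_monomial]
  rw [coeff_monomial_mul']
  rcases h.lt_or_eq with h | rfl
  · rw [if_neg, if_neg]
    · omega
    · intro h'
      have := h' 0
      simp at this
      omega
  · rw [if_pos (by simp), add_tsub_cancel_left, coeff_add, coeff_X_mul', if_neg (by simp)]
    simp [coeff_monomial, (Finsupp.single_injective (1 : Fin 2)).eq_iff, eq_comm]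

theorem linearIndependent_stringFamily : LinearIndependent K (stringFamily K σ) := by
  rw [linearIndependent_iff']
  intro t a ha
  suffices H : ∀ c r, (r, c) ∈ t → a (r, c) = 0 from fun b hb => H b.2 b.1 hb
  intro c
  induction c using Nat.strong_induction_on with
  | _ c ih =>
    intro r hr
    have h := congrArg (coeff (Finsupp.single 0 c + Finsupp.single 1 r)) ha
    rw [coeff_sum, Finset.sum_eq_single (r, c)] at h
    · simpa [coeff_stringFamily] using h
    · rintro ⟨r', c'⟩ hb hne
      rw [coeff_smul]
      rcases lt_or_ge c' c with hc | hc
      · rw [ih c' hc r' hb, zero_smul]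
      · rw [coeff_stringFamily σ r' r c c' hc, if_neg, smul_zero]
        rintro ⟨rfl, rfl⟩
        exact hne rfl
    · exact fun h' => absurd hr h'

/-- A subspace of `K[x,y]` closed under multiplication by the variables is an ideal. -/
theorem mul_mem_of_X_mul_mem {n : ℕ} {W : Submodule K (MvPolynomial (Fin n) K)}
    (h : ∀ i, ∀ w ∈ W, X i * w ∈ W) (q w : MvPolynomial (Fin n) K) (hw : w ∈ W) : q * w ∈ W := by
  induction q using MvPolynomial.induction_on generalizing w with
  | C a => rw [C_mul']; exact W.smul_mem _ hw
  | add p q hp hq => rw [add_mul]; exact W.add_mem (hp w hw) (hq w hw)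
  | mul_X p i hp => rw [mul_assoc]; exact hp _ (h i w hw)

/-- If a set of boxes is closed under moving right, down and from `(r, c)` to
`(σ r, c + r + 1 - σ r)`, then the corresponding part of `stringFamily` spans an ideal. -/
theorem mul_mem_span_stringFamily {Q : Set (ℕ × ℕ)}
    (h0 : ∀ r c, (r, c) ∈ Q → (r, c + 1) ∈ Q) (h1 : ∀ r c, (r, c) ∈ Q → (r + 1, c) ∈ Q)
    (h2 : ∀ r c, (r, c) ∈ Q → σ r ≤ r → (σ r, c + (r + 1 - σ r)) ∈ Q)
    (q w : MvPolynomial (Fin 2) K) (hw : w ∈ Submodule.span K (stringFamily K σ '' Q)) :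
    q * w ∈ Submodule.span K (stringFamily K σ '' Q) := by
  refine mul_mem_of_X_mul_mem ?_ q w hw
  intro i w hw
  induction hw using Submodule.span_induction with
  | zero => simp
  | add x y _ _ hx hy => rw [mul_add]; exact Submodule.add_mem _ hx hy
  | smul a x _ hx => rw [mul_smul_comm]; exact Submodule.smul_mem _ _ hx
  | mem x hx =>
    obtain ⟨⟨r, c⟩, hb, rfl⟩ := hx
    have hS : ∀ b ∈ Q, stringFamily K σ b ∈ Submodule.span K (stringFamily K σ '' Q) :=
      fun b hb => Submodule.subset_span ⟨b, hb, rfl⟩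
    fin_cases i
    · exact X_zero_mul_stringFamily (K := K) σ r c ▸ hS _ (h0 r c hb)
    · change X 1 * _ ∈ _
      rw [X_one_mul_stringFamily]
      refine Submodule.sub_mem _ (hS _ (h1 r c hb)) ?_
      split_ifs with h
      · exact hS _ (h2 r c hb h)
      · exact Submodule.zero_mem _

theorem span_stringFamily : Submodule.span K (Set.range (stringFamily K σ)) = ⊤ := by
  rw [eq_top_iff, ← Set.image_univ]
  intro q _
  rw [← mul_one q]
  refine mul_mem_span_stringFamily σ (by simp) (by simp) (by simp) q 1 ?_
  exact Submodule.subset_span ⟨(0, 0), trivial, by simp [stringFamily, stringGen]⟩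

theorem span_stringFamily_degree (i : ℕ) :
    Submodule.span K (stringFamily K σ '' {b | b.1 + b.2 = i}) =
      homogeneousSubmodule (Fin 2) K i := by
  apply le_antisymm
  · rw [Submodule.span_le]
    rintro _ ⟨b, rfl, rfl⟩
    exact stringFamily_isHomogeneous σ b
  · intro q hq
    -- Projecting an expansion of `q` onto degree `i` discards exactly the family members of other
    -- degrees.
    rw [← homogeneousComponent_eq_self hq]
    have : q ∈ Submodule.span K (Set.range (stringFamily K σ)) := by
      rw [span_stringFamily]; trivial
    clear hq
    induction this using Submodule.span_induction with
    | zero => simp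
    | add x y _ _ hx hy => rw [map_add]; exact Submodule.add_mem _ hx hy
    | smul a x _ hx => rw [map_smul]; exact Submodule.smul_mem _ _ hx
    | mem x hx =>
      obtain ⟨b, rfl⟩ := hx
      rw [homogeneousComponent_of_mem (stringFamily_isHomogeneous σ b)]
      split_ifs with h
      · exact Submodule.subset_span ⟨b, h.symm, rfl⟩
      · exact Submodule.zero_mem _

end Strings

/-! ### Regular sequences of length two in a domain. -/

theorem isRegular_pair_iff {R : Type*} [CommRing R] [IsDomain R] (f g : R) :
    RingTheory.Sequence.IsRegular R [f, g] ↔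
      f ≠ 0 ∧ (∀ h, f ∣ g * h → f ∣ h) ∧ Ideal.span {f, g} ≠ ⊤ := by
  have h0 : IsSMulRegular (R ⧸ (Ideal.ofList ([f, g].take 0) • ⊤ : Submodule R R)) f ↔ f ≠ 0 := by
    rw [isSMulRegular_quotient_iff_mem_of_smul_mem]
    simp only [List.take_zero, Ideal.ofList_nil, smul_eq_mul, Ideal.bot_mul, Ideal.mem_bot]
    refine ⟨fun h hf => one_ne_zero (h 1 (by simp [hf])), fun h x hx => ?_⟩
    exact (mul_eq_zero.mp hx).resolve_left h
  have h1 : IsSMulRegular (R ⧸ (Ideal.ofList ([f, g].take 1) • ⊤ : Submodule R R)) g ↔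
      ∀ h, f ∣ g * h → f ∣ h := by
    rw [isSMulRegular_quotient_iff_mem_of_smul_mem]
    simp [Ideal.mem_span_singleton]
  rw [RingTheory.Sequence.isRegular_iff, RingTheory.Sequence.isWeaklyRegular_iff, and_assoc.symm,
    ← h0, ← h1]
  refine and_congr ⟨fun h => ⟨h 0 (by simp), h 1 (by simp)⟩, ?_⟩ ?_
  · rintro ⟨h0, h1⟩ i hi
    match i with
    | 0 => exact h0
    | 1 => exact h1
    | i + 2 => simp at hi
  · rw [ne_comm, Ideal.span_insert]
    simp

/-! ### Diagonal lengths and the degrees in which rows end. -/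

theorem numParts_eq_colLen (P : YoungDiagram) : numParts P = P.colLen 0 :=
  P.length_rowLens

theorem rowLen_pos_iff (P : YoungDiagram) (r : ℕ) : 0 < P.rowLen r ↔ r < numParts P := by
  rw [numParts_eq_colLen, ← YoungDiagram.mem_iff_lt_colLen, YoungDiagram.mem_iff_lt_rowLen]

theorem diagonalLength_eq_card_rows (P : YoungDiagram) (i : ℕ) :
    diagonalLength P i = ((Finset.range (i + 1)).filter fun r => i < r + P.rowLen r).card := by
  refine Finset.card_bij (fun c _ => c.1) ?_ ?_ ?_
  · rintro ⟨r, c⟩ h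
    simp only [Finset.mem_filter, YoungDiagram.mem_cells, YoungDiagram.mem_iff_lt_rowLen,
      Finset.mem_range] at h ⊢
    omega
  · rintro ⟨r, c⟩ h ⟨r', c'⟩ h' hr
    simp only [Finset.mem_filter] at h h' hr
    ext <;> simp only <;> omega
  · intro r h
    refine ⟨(r, i - r), ?_, rfl⟩
    simp only [Finset.mem_filter, YoungDiagram.mem_cells, YoungDiagram.mem_iff_lt_rowLen,
      Finset.mem_range] at h ⊢
    omega

/-- The diagonal lengths and the number of parts determine how many rows end on each diagonal. -/
theorem card_rows_ending (P : YoungDiagram) (i : ℕ) :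
    ((Finset.range (numParts P)).filter fun r => r + P.rowLen r = i + 1).card +
      diagonalLength P (i + 1) = diagonalLength P i + if i + 1 < numParts P then 1 else 0 := by
  have h1 : ((Finset.range (i + 2)).filter fun r => i + 1 < r + P.rowLen r).card =
      ((Finset.range (i + 1)).filter fun r => i + 1 < r + P.rowLen r).card +
        if i + 1 < numParts P then 1 else 0 := by
    rw [Finset.range_add_one, Finset.filter_insert]
    have := rowLen_pos_iff P (i + 1)
    split_ifs with h2 h3 h3
    · rw [Finset.card_insert_of_notMem (by simp)]
    · omega
    · omega
    · simp
  rw [diagonalLength_eq_card_rows, diagonalLength_eq_card_rows, h1, ← add_assoc,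
    ← Finset.card_union_of_disjoint]
  · congr 2
    ext r
    have := rowLen_pos_iff P r
    simp only [Finset.mem_union, Finset.mem_filter, Finset.mem_range]
    omega
  · rw [Finset.disjoint_left]
    intro r
    simp only [Finset.mem_filter]
    omega

section RowEnds

/-- Each of the degrees `m, …, m + n - 1`, where `n` is the number of rows of `P`, is the degree of
the last box of exactly one row, and no other degree is. -/
def RowsEndOnceFrom (P : YoungDiagram) (m : ℕ) : Prop :=
  ∀ v, ((Finset.range (numParts P)).filter fun r => r + P.rowLen r = v + 1).card =
    if m ≤ v ∧ v < m + numParts P then 1 else 0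

/-- By `card_rows_ending`, `T_i - T_{i+1} + [i + 1 < n]` rows end in degree `i`. For `n = d` this is
`1` exactly on the descent of `T`; for `n = d + k - 1` the plateau contributes as well. -/
theorem rowsEndOnceFrom_of_diagonalLength {d k : ℕ} (hd : 2 ≤ d) (hk : 1 ≤ k) {P : YoungDiagram}
    (hP : ∀ i, diagonalLength P i = ciHilbertFunction d k i)
    (hn : numParts P = d ∨ numParts P = d + k - 1) :
    RowsEndOnceFrom P (2 * d + k - 2 - numParts P) := by
  intro v
  have h := card_rows_ending P v
  rw [hP, hP] at h
  unfold ciHilbertFunction at h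
  rcases hn with hn | hn <;> rw [hn] at h ⊢ <;> split_ifs at h ⊢ <;> omega

namespace RowsEndOnceFrom

variable {P : YoungDiagram} {m : ℕ} (h : RowsEndOnceFrom P m)
include h

theorem unique {r s : ℕ} (hr : r < numParts P) (hs : s < numParts P)
    (hrs : r + P.rowLen r = s + P.rowLen s) : r = s := by
  have hpos := (rowLen_pos_iff P r).mpr hr
  have h1 := h (r + P.rowLen r - 1)
  have h2 : ((Finset.range (numParts P)).filter
      fun t => t + P.rowLen t = r + P.rowLen r - 1 + 1).card ≤ 1 := by
    rw [h1]; split_ifs <;> omega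
  rw [Finset.card_le_one] at h2
  refine h2 r ?_ s ?_ <;> simp only [Finset.mem_filter, Finset.mem_range] <;> omega

theorem exists_row {v : ℕ} (h1 : m ≤ v) (h2 : v < m + numParts P) :
    ∃ r < numParts P, r + P.rowLen r = v + 1 := by
  have h3 := h v
  rw [if_pos ⟨h1, h2⟩] at h3
  obtain ⟨r, hr⟩ := Finset.card_pos.mp (by rw [h3]; exact one_pos)
  simp only [Finset.mem_filter, Finset.mem_range] at hr
  exact ⟨r, hr⟩

theorem bounds {r : ℕ} (hr : r < numParts P) :
    m < r + P.rowLen r ∧ r + P.rowLen r ≤ m + numParts P := by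
  have hpos := (rowLen_pos_iff P r).mpr hr
  have h1 := h (r + P.rowLen r - 1)
  have h2 : 0 < ((Finset.range (numParts P)).filter
      fun t => t + P.rowLen t = r + P.rowLen r - 1 + 1).card := by
    refine Finset.card_pos.mpr ⟨r, ?_⟩
    simp only [Finset.mem_filter, Finset.mem_range]
    omega
  rw [h1] at h2
  split_ifs at h2 <;> omega

/-- From one row to the next the end degree rises by at most one. If row `r + 1` is not the one
ending just after row `r`, it ends before row `r`, and later rows could climb past that degree only
by repeating it. -/
theorem eq_succ_of_lt {r s : ℕ} (hs : s < numParts P) (hrs : r < s)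
    (he : r + P.rowLen r + 1 = s + P.rowLen s) : s = r + 1 := by
  by_contra hne
  have key : ∀ t, r + 1 + t ≤ s → r + 1 + t + P.rowLen (r + 1 + t) < r + P.rowLen r := by
    intro t
    induction t with
    | zero =>
      intro _
      have h1 := P.rowLen_anti r (r + 1) (by omega)
      have h2 := mt (h.unique (r := r + 1) (s := s) (by omega) hs) (by omega)
      have h3 := mt (h.unique (r := r + 1) (s := r) (by omega) (by omega)) (by omega)
      simp only [add_zero]
      omega
    | succ t ih =>
      intro ht
      have h0 := ih (by omega)
      have h1 := P.rowLen_anti (r + 1 + t) (r + 1 + (t + 1)) (by omega)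
      have h3 := mt (h.unique (r := r + 1 + (t + 1)) (s := r) (by omega) (by omega)) (by omega)
      omega
  have := key (s - r - 1) (by omega)
  rw [show r + 1 + (s - r - 1) = s by omega] at this
  omega

end RowsEndOnceFrom

/-- A map sending a row to an earlier row that ends one degree later, where there is one. -/
theorem exists_earlier_row (P : YoungDiagram) : ∃ σ : ℕ → ℕ,
    (∀ r, σ r ≤ r → r < numParts P ∧ σ r + P.rowLen (σ r) = r + P.rowLen r + 1) ∧
    ∀ r < numParts P, ∀ s ≤ r, s + P.rowLen s = r + P.rowLen r + 1 → σ r ≤ r := by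
  have H : ∀ r, ∃ s, (s ≤ r → r < numParts P ∧ s + P.rowLen s = r + P.rowLen r + 1) ∧
      (r < numParts P → ∀ t ≤ r, t + P.rowLen t = r + P.rowLen r + 1 → s ≤ r) := by
    intro r
    by_cases hr : r < numParts P ∧ ∃ s ≤ r, s + P.rowLen s = r + P.rowLen r + 1
    · obtain ⟨hr, s, hs, he⟩ := hr
      exact ⟨s, fun _ => ⟨hr, he⟩, fun _ _ _ _ => hs⟩
    -- The value `r + 1`, exceeding `r`, encodes that no such earlier row exists.
    · exact ⟨r + 1, fun h => by omega, fun h1 t h2 h3 => absurd ⟨h1, t, h2, h3⟩ hr⟩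
  choose σ hσ using H
  exact ⟨σ, fun r => (hσ r).1, fun r => (hσ r).2⟩

end RowEnds

/-! ### The complete intersection attached to `P`. -/

section Construction

open MvPolynomial

variable {K : Type*} [Field K]

theorem span_pair_eq_span_stringFamily {P : YoungDiagram} {m : ℕ} (h : RowsEndOnceFrom P m)
    {σ : ℕ → ℕ}
    (hσ : ∀ r, σ r ≤ r → r < numParts P ∧ σ r + P.rowLen (σ r) = r + P.rowLen r + 1)
    (hσ' : ∀ r < numParts P, ∀ s ≤ r, s + P.rowLen s = r + P.rowLen r + 1 → σ r ≤ r)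
    {r₀ : ℕ} (hr₀ : r₀ < numParts P) (hm : r₀ + P.rowLen r₀ = m + 1) :
    (Ideal.span {stringFamily K σ (numParts P, 0),
      stringFamily K σ (r₀, P.rowLen r₀)}).restrictScalars K =
    Submodule.span K (stringFamily K σ '' {b | P.rowLen b.1 ≤ b.2}) := by
  set n := numParts P with hn
  have hn0 : ∀ r, n ≤ r → P.rowLen r = 0 := fun r hr => by
    have := rowLen_pos_iff P r
    omega
  apply le_antisymm
  · intro q hq
    obtain ⟨a, b, rfl⟩ := Ideal.mem_span_pair.mp (show q ∈ Ideal.span _ from hq)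
    have hmul := mul_mem_span_stringFamily (K := K) σ (Q := {b | P.rowLen b.1 ≤ b.2})
      (fun r c h => by simp only [Set.mem_ofPred_eq] at h ⊢; omega)
      (fun r c h => by
        have := P.rowLen_anti r (r + 1) (by omega)
        simp only [Set.mem_ofPred_eq] at h ⊢; omega)
      (fun r c h hr => by
        have := hσ r hr
        simp only [Set.mem_ofPred_eq] at h ⊢; omega)
    refine Submodule.add_mem _ (hmul _ _ ?_) (hmul _ _ ?_)
    · exact Submodule.subset_span ⟨_, (hn0 n le_rfl).le, rfl⟩
    · exact Submodule.subset_span ⟨_, le_refl (P.rowLen r₀), rfl⟩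
  · set I := Ideal.span {stringFamily K σ (n, 0), stringFamily K σ (r₀, P.rowLen r₀)} with hI
    have hshift : ∀ r c t, stringFamily K σ (r, c) ∈ I → stringFamily K σ (r, c + t) ∈ I := by
      intro r c t hc
      have : stringFamily K σ (r, c + t) = X 0 ^ t * stringFamily K σ (r, c) := by
        simp only [stringFamily]; ring
      rw [this]
      exact I.mul_mem_left _ hc
    have hbig : ∀ t, stringFamily K σ (n + t, 0) ∈ I := by
      intro t
      induction t with
      | zero => exact Ideal.subset_span (by simp)
      | succ t ih =>
        have h1 := X_one_mul_stringFamily (K := K) σ (n + t) 0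
        -- Beyond the last row there are no corrections, so multiplication by `y` takes each `e_r`
        -- to the next.
        rw [if_neg (fun h => by have := (hσ _ h).1; omega), sub_zero] at h1
        rw [← add_assoc, ← h1]
        exact I.mul_mem_left _ ih
    have hsmall : ∀ v s, s < n → s + P.rowLen s = v → stringFamily K σ (s, P.rowLen s) ∈ I := by
      intro v
      induction v using Nat.strong_induction_on with
      | _ v ih =>
        intro s hs hv
        by_cases hsm : s + P.rowLen s = m + 1
        · rw [h.unique hs hr₀ (by omega)]
          exact Ideal.subset_span (by simp)
        · have hb := h.bounds hs
          -- Row `r` ends one degree before row `s`. The shift is by `2` because `exists_row` is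
          -- indexed by the degree of the last box, which is one less than `r + p_r`.
          obtain ⟨r, hr, her⟩ := h.exists_row (v := s + P.rowLen s - 2) (by omega) (by omega)
          have hrI := ih _ (by omega) r hr rfl
          have hX := I.mul_mem_left (X 1) hrI
          rw [X_one_mul_stringFamily] at hX
          rcases lt_trichotomy r s with hrs | rfl | hrs
          -- Here `p_{r+1} = p_r` and no correction occurs, so `y` carries one row end directly to
          -- the other.
          · obtain rfl := h.eq_succ_of_lt hs hrs (by omega)
            rw [if_neg, sub_zero] at hX
            · rwa [show P.rowLen (r + 1) = P.rowLen r by omega]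
            · intro hle
              have h1 := hσ r hle
              have := h.unique (r := σ r) (s := r + 1) (by omega) hs (by omega)
              omega
          · omega
          -- Here `σ r = s`, and the correction term is exactly the first missing box of row `s`.
          -- The other term lies in row `r + 1`, which is either beyond `P` or ends before row `s`,
          -- so it is already in `I`.
          · have hle := hσ' r hr s hrs.le (by omega)
            have h1 := hσ r hle
            have h2 := h.unique (r := σ r) (s := s) (by omega) hs (by omega)
            rw [if_pos hle, h2, show P.rowLen r + (r + 1 - s) = P.rowLen s by omega] at hX
            have h3 : stringFamily K σ (r + 1, P.rowLen r) ∈ I := by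
              have hanti := P.rowLen_anti r (r + 1) (by omega)
              rw [show P.rowLen r = P.rowLen (r + 1) + (P.rowLen r - P.rowLen (r + 1)) by omega]
              apply hshift
              rcases lt_or_ge (r + 1) n with hlt | hge
              · have h4 := mt (h.unique (r := r + 1) (s := s) hlt hs) (by omega)
                exact ih _ (by omega) (r + 1) hlt rfl
              · rw [hn0 _ hge]
                obtain ⟨t, ht⟩ := Nat.exists_eq_add_of_le hge
                rw [ht]
                exact hbig t
            exact (Submodule.sub_mem_iff_right I h3).mp hX
    rw [Submodule.span_le]
    rintro _ ⟨⟨r, c⟩, hrc, rfl⟩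
    simp only [Set.mem_ofPred_eq] at hrc
    obtain ⟨t, rfl⟩ := Nat.exists_eq_add_of_le hrc
    refine hshift r _ t ?_
    rcases lt_or_ge r n with hlt | hge
    · exact hsmall _ r hlt rfl
    · rw [hn0 _ hge]
      obtain ⟨t, ht⟩ := Nat.exists_eq_add_of_le hge
      rw [ht]
      exact hbig t

theorem not_X_zero_dvd_stringGen (σ : ℕ → ℕ) (r : ℕ) :
    ¬ (X 0 : MvPolynomial (Fin 2) K) ∣ stringGen K σ r := by
  obtain ⟨u, hu⟩ := stringGen_eq_pow_add (K := K) σ r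
  rw [hu, dvd_add_left (dvd_mul_right _ _)]
  intro h
  have := (X_prime (R := K) (i := (0 : Fin 2))).dvd_of_dvd_pow h
  rw [X_dvd_X] at this
  simp at this

theorem exists_ci_of_rowsEndOnce {P : YoungDiagram} {m : ℕ} (h : RowsEndOnceFrom P m)
    (hpos : 0 < numParts P) : IsCIJordanType K (diagonalLength P) P := by
  obtain ⟨σ, hσ, hσ'⟩ := exists_earlier_row P
  obtain ⟨r₀, hr₀, hm⟩ := h.exists_row (v := m) le_rfl (by omega)
  have hspan := span_pair_eq_span_stringFamily (K := K) h hσ hσ' hr₀ hm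
  set f := stringFamily K σ (numParts P, 0) with hf
  set g := stringFamily K σ (r₀, P.rowLen r₀) with hg
  set I := Ideal.span {f, g} with hI
  have hmem : ∀ q, q ∈ I ↔ q ∈ Submodule.span K (stringFamily K σ '' {b | P.rowLen b.1 ≤ b.2}) :=
    fun q => by rw [← hspan]; rfl
  have hLI := linearIndependent_stringFamily (K := K) σ
  have hcell : ∀ b, b ∈ P.cells ↔ ¬ P.rowLen b.1 ≤ b.2 := fun b => by
    rw [YoungDiagram.mem_cells, not_le, ← YoungDiagram.mem_iff_lt_rowLen]
  have hker : LinearMap.ker (Ideal.Quotient.mkₐ K I).toLinearMap =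
      Submodule.span K (stringFamily K σ '' {b | P.rowLen b.1 ≤ b.2}) := by
    rw [← hspan]
    ext q
    simp [Ideal.Quotient.eq_zero_iff_mem]
  set v : {c : ℕ × ℕ // c ∈ P.cells} → MvPolynomial (Fin 2) K ⧸ I :=
    fun c => Ideal.Quotient.mkₐ K I (stringFamily K σ c.1) with hv
  have hvLI : LinearIndependent K v := by
    refine (hLI.comp _ Subtype.val_injective).map
      (f := (Ideal.Quotient.mkₐ K I).toLinearMap) ?_
    rw [hker, Set.range_comp]
    apply hLI.disjoint_span_image
    rw [Set.disjoint_left]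
    rintro _ ⟨c, rfl⟩ h'
    exact (hcell _).mp c.2 h'
  have hzero : ∀ b, b ∉ P.cells → Ideal.Quotient.mkₐ K I (stringFamily K σ b) = 0 := by
    intro b hb
    rw [hcell, not_not] at hb
    exact Ideal.Quotient.eq_zero_iff_mem.mpr ((hmem _).mpr (Submodule.subset_span ⟨b, hb, rfl⟩))
  have himage : ∀ Q : Set (ℕ × ℕ), (Submodule.span K (stringFamily K σ '' Q)).map
      (Ideal.Quotient.mkₐ K I).toLinearMap = Submodule.span K (v '' {c | c.1 ∈ Q}) := by
    intro Q
    rw [Submodule.map_span]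
    apply le_antisymm
    · rw [Submodule.span_le]
      rintro _ ⟨_, ⟨b, hb, rfl⟩, rfl⟩
      by_cases hbP : b ∈ P.cells
      · exact Submodule.subset_span ⟨⟨b, hbP⟩, hb, rfl⟩
      · change Ideal.Quotient.mkₐ K I (stringFamily K σ b) ∈ _
        rw [hzero b hbP]
        exact Submodule.zero_mem _
    · apply Submodule.span_mono
      rintro _ ⟨c, hc, rfl⟩
      exact ⟨_, ⟨c.1, hc, rfl⟩, rfl⟩
  have hvspan : ⊤ ≤ Submodule.span K (Set.range v) := by
    have := himage Set.univ
    rw [Set.image_univ, span_stringFamily, Submodule.map_top, LinearMap.range_eq_top.mpr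
      (Ideal.Quotient.mkₐ_surjective K I)] at this
    rw [this]
    exact Submodule.span_mono (Set.image_subset_range _ _)
  let bas := Module.Basis.mk hvLI hvspan
  refine ⟨I, ⟨Module.Finite.of_basis bas, f, g, _, _, stringFamily_isHomogeneous σ _,
    stringFamily_isHomogeneous σ _, ?_, rfl⟩, ?_, X 0, isHomogeneous_X _ _, bas, ?_⟩
  · rw [isRegular_pair_iff]
    refine ⟨hLI.ne_zero _, ?_, ?_⟩
    · intro q hq
      -- This element is `x^p₀`. Thus `f ∣ g q` gives `f ∣ x^p₀ q`, and the power of the prime `x`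
      -- cancels because `x` does not divide `f`.
      have h1 : stringFamily K σ (0, P.rowLen 0) ∈ I :=
        (hmem _).mpr (Submodule.subset_span ⟨_, le_refl (P.rowLen 0), rfl⟩)
      obtain ⟨a, b, hab⟩ := Ideal.mem_span_pair.mp h1
      have h2 : f ∣ X 0 ^ P.rowLen 0 * q := by
        have : X 0 ^ P.rowLen 0 * q = f * (a * q) + b * (g * q) := by
          have : stringFamily K σ (0, P.rowLen 0) = X 0 ^ P.rowLen 0 := by
            simp [stringFamily, stringGen]
          rw [← this, ← hab]
          ring
        rw [this]
        exact dvd_add (dvd_mul_right _ _) (dvd_mul_of_dvd_right hq _)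
      obtain ⟨w, hw⟩ := h2
      have hndvd : ¬ (X 0 : MvPolynomial (Fin 2) K) ∣ f := by
        rw [hf]
        simpa [stringFamily] using not_X_zero_dvd_stringGen (K := K) σ (numParts P)
      obtain ⟨w', rfl⟩ := (X_prime (R := K) (i := (0 : Fin 2))).pow_dvd_of_dvd_mul_left _ hndvd
        ⟨q, hw.symm⟩
      refine ⟨w', mul_left_cancel₀ (pow_ne_zero (P.rowLen 0) (X_ne_zero (R := K) (0 : Fin 2))) ?_⟩
      rw [hw]; ring
    · rw [Ne, Ideal.eq_top_iff_one, ← hI, hmem]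
      have h00 : stringFamily K σ (0, 0) = 1 := by simp [stringFamily, stringGen]
      rw [← h00]
      apply hLI.notMem_span_image
      have := (rowLen_pos_iff P 0).mpr hpos
      simp only [Set.mem_ofPred_eq]
      omega
  · intro i
    rw [hilbertFunction, ← span_stringFamily_degree σ, himage, Set.image_eq_range]
    change Module.finrank K (Submodule.span K (Set.range (v ∘ Subtype.val))) = _
    rw [finrank_span_eq_card (hvLI.comp _ Subtype.val_injective), diagonalLength]
    rw [← Nat.card_eq_fintype_card, ← Nat.card_eq_finsetCard]
    refine Nat.card_congr ⟨fun c => ⟨c.1.1, ?_⟩, fun c => ⟨⟨c.1, ?_⟩, ?_⟩, fun _ => rfl,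
      fun _ => rfl⟩
    · exact Finset.mem_filter.mpr ⟨c.1.2, c.2⟩
    · exact (Finset.mem_filter.mp c.2).1
    · exact (Finset.mem_filter.mp c.2).2
  · intro r c hrc
    simp only [bas, Module.Basis.mk_apply, hv, LinearMap.mulLeft_apply]
    have h1 : Ideal.Quotient.mk I (X 0) * Ideal.Quotient.mkₐ K I (stringFamily K σ (r, c)) =
        Ideal.Quotient.mkₐ K I (stringFamily K σ (r, c + 1)) := by
      rw [← X_zero_mul_stringFamily, map_mul]; rfl
    rw [h1]
    split_ifs with h'
    · rfl
    · exact hzero _ h'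

end Construction

/-! ### The Hilbert function determines the generator degrees. -/

section HilbertFunction

open MvPolynomial

variable {K : Type*} [Field K]

theorem finrank_homogeneousSubmodule_fin_two (i : ℕ) :
    Module.finrank K (homogeneousSubmodule (Fin 2) K i) = i + 1 := by
  -- With `σ r = r + 1` there are no corrections, and the family is the monomial basis.
  rw [← span_stringFamily_degree (fun r => r + 1), Set.image_eq_range]
  have hLI := (linearIndependent_stringFamily (K := K) (fun r => r + 1)).comp
    (Subtype.val : {b : ℕ × ℕ // b.1 + b.2 = i} → ℕ × ℕ) Subtype.val_injective
  let e : {b : ℕ × ℕ // b.1 + b.2 = i} ≃ Finset.HasAntidiagonal.antidiagonal i :=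
    Equiv.subtypeEquivRight fun _ => Finset.HasAntidiagonal.mem_antidiagonal.symm
  have := Fintype.ofEquiv _ e.symm
  change Module.finrank K (Submodule.span K (Set.range (stringFamily K (fun r => r + 1) ∘
    (Subtype.val : {b : ℕ × ℕ // b.1 + b.2 = i} → ℕ × ℕ)))) = _
  rw [finrank_span_eq_card hLI, Fintype.card_congr e, Fintype.card_coe,
    Finset.Nat.card_antidiagonal]

theorem hilbertFunction_add_finrank_inf (I : Ideal (MvPolynomial (Fin 2) K)) (i : ℕ) :
    hilbertFunction I i + Module.finrank K
      ↥(homogeneousSubmodule (Fin 2) K i ⊓ I.restrictScalars K) = i + 1 := by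
  have : Module.Finite K (homogeneousSubmodule (Fin 2) K i) :=
    Module.Finite.iff_fg.mpr (homogeneousSubmodule_fg (Fin 2) K i)
  have h := LinearMap.finrank_range_add_finrank_ker
    ((Ideal.Quotient.mkₐ K I).toLinearMap.domRestrict (homogeneousSubmodule (Fin 2) K i))
  rw [finrank_homogeneousSubmodule_fin_two, LinearMap.range_domRestrict,
    LinearMap.ker_domRestrict] at h
  have hker : LinearMap.ker (Ideal.Quotient.mkₐ K I).toLinearMap = I.restrictScalars K := by
    ext q
    simp [Ideal.Quotient.eq_zero_iff_mem]
  rw [hker] at h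
  rw [← Submodule.map_comap_subtype, ← (Submodule.equivMapOfInjective _
    (homogeneousSubmodule (Fin 2) K i).subtype_injective _).finrank_eq]
  exact h

theorem homogeneousComponent_mul_of_isHomogeneous {g : MvPolynomial (Fin 2) K} {b : ℕ}
    (hg : g.IsHomogeneous b) (v : MvPolynomial (Fin 2) K) (i : ℕ) :
    homogeneousComponent i (v * g) = if b ≤ i then homogeneousComponent (i - b) v * g else 0 := by
  have hv : v ∈ Submodule.span K (Set.range (stringFamily K fun r => r + 1)) := by
    rw [span_stringFamily]; trivial
  induction hv using Submodule.span_induction with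
  | zero => simp
  | add x y _ _ hx hy => rw [add_mul, map_add, hx, hy, map_add]; split_ifs <;> ring
  | smul a x _ hx => rw [smul_mul_assoc, map_smul, hx, map_smul]; split_ifs <;> simp
  | mem x hx =>
    obtain ⟨c, rfl⟩ := hx
    have hc := stringFamily_isHomogeneous (K := K) (fun r => r + 1) c
    rw [homogeneousComponent_of_mem (hc.mul hg), homogeneousComponent_of_mem hc]
    split_ifs <;> first | rfl | omega

theorem mem_inf_span_pair {f g : MvPolynomial (Fin 2) K} {a b i : ℕ} (hf : f.IsHomogeneous a)
    (hg : g.IsHomogeneous b) (hi : i < b) {q : MvPolynomial (Fin 2) K}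
    (hq : q ∈ homogeneousSubmodule (Fin 2) K i ⊓ (Ideal.span {f, g}).restrictScalars K) :
    ∃ u, q = if a ≤ i then homogeneousComponent (i - a) u * f else 0 := by
  obtain ⟨u, v, huv⟩ := Ideal.mem_span_pair.mp (show q ∈ Ideal.span _ from hq.2)
  refine ⟨u, ?_⟩
  rw [← homogeneousComponent_mul_of_isHomogeneous hf, ← homogeneousComponent_eq_self hq.1, ← huv,
    map_add, homogeneousComponent_mul_of_isHomogeneous hg, if_neg (by omega), add_zero]

/-- The degrees of the generators of a complete intersection are determined by its Hilbert
function. -/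
theorem degrees_eq_of_hilbertFunction {f g : MvPolynomial (Fin 2) K} {a b d k : ℕ} (hd : 2 ≤ d)
    (hk : 1 ≤ k) (hf : f.IsHomogeneous a) (hg : g.IsHomogeneous b) (hab : a ≤ b) (hf0 : f ≠ 0)
    (hfg : ¬ f ∣ g)
    (hT : ∀ i, hilbertFunction (Ideal.span {f, g}) i = ciHilbertFunction d k i) :
    a = d ∧ b = d + k - 1 := by
  set I := Ideal.span {f, g} with hI
  let F : ℕ → Submodule K (MvPolynomial (Fin 2) K) := fun i =>
    homogeneousSubmodule (Fin 2) K i ⊓ I.restrictScalars K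
  have hadd : ∀ i, ciHilbertFunction d k i + Module.finrank K (F i) = i + 1 := fun i => by
    rw [← hT]; exact hilbertFunction_add_finrank_inf I i
  have hfin : ∀ i, Module.Finite K (F i) := fun i => by
    have : Module.Finite K (homogeneousSubmodule (Fin 2) K i) :=
      Module.Finite.iff_fg.mpr (homogeneousSubmodule_fg (Fin 2) K i)
    exact Submodule.finiteDimensional_inf_left _ _
  let S : ℕ → Submodule K (MvPolynomial (Fin 2) K) := fun i =>
    (homogeneousSubmodule (Fin 2) K (i - a)).map (LinearMap.mulRight K f)
  have hS : ∀ i, Module.finrank K (S i) = i - a + 1 := fun i => by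
    rw [← finrank_homogeneousSubmodule_fin_two (K := K) (i - a)]
    refine (LinearEquiv.finrank_eq (Submodule.equivMapOfInjective _ ?_ _)).symm
    exact fun p q hpq => mul_right_cancel₀ hf0 hpq
  have hSF : ∀ i, a ≤ i → S i ≤ F i := by
    rintro i hi _ ⟨q, hq, rfl⟩
    refine ⟨?_, I.mul_mem_left q (Ideal.subset_span (by simp))⟩
    have := IsHomogeneous.mul hq hf
    rwa [show i - a + a = i by omega] at this
  have h1 : ∀ i, i < a → Module.finrank K (F i) = 0 := by
    intro i hi
    have : F i = ⊥ := by
      rw [eq_bot_iff]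
      intro q hq
      obtain ⟨u, hu⟩ := mem_inf_span_pair hf hg (by omega) hq
      rw [if_neg (by omega)] at hu
      exact hu
    rw [this, finrank_bot]
  have h3 : ∀ i, a ≤ i → i < b → Module.finrank K (F i) = i - a + 1 := by
    intro i hi hib
    rw [← hS]
    suffices hFS : F i = S i by rw [hFS]
    refine le_antisymm ?_ (hSF i hi)
    intro q hq
    obtain ⟨u, hu⟩ := mem_inf_span_pair hf hg hib hq
    rw [if_pos hi] at hu
    exact ⟨_, homogeneousComponent_isHomogeneous _ u, hu.symm⟩
  have h2 : ∀ i, a ≤ i → i - a + 1 ≤ Module.finrank K (F i) := by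
    intro i hi
    rw [← hS]
    have := hfin i
    exact Submodule.finrank_mono (hSF i hi)
  -- In degree `b` the form `g` is new, as it is not a multiple of `f`.
  have h4 : b - a + 1 < Module.finrank K (F b) := by
    rw [← hS]
    have := hfin b
    refine Submodule.finrank_lt_finrank_of_lt (lt_of_le_of_ne (hSF b hab) ?_)
    intro heq
    have : g ∈ S b := by
      rw [heq]
      exact ⟨hg, Ideal.subset_span (by simp)⟩
    obtain ⟨q, -, hq⟩ := this
    exact hfg ⟨q, by rw [mul_comm]; exact hq.symm⟩
  unfold ciHilbertFunction at hadd
  -- The first degree in which `T_i < i + 1` is `d`, and the first nonzero form of the ideal has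
  -- degree `a`.
  have had : a = d := by
    have e1 := hadd d
    have e2 := hadd a
    have e3 := h2 a le_rfl
    by_contra hne
    rcases lt_or_gt_of_ne hne with hlt | hlt
    · omega
    · have e4 := h1 d hlt
      omega
  refine ⟨had, ?_⟩
  -- The extra form in degree `b` makes `T_b < d`, so `b` lies beyond the plateau. A larger `b` than
  -- `d + k - 1` would keep the value `d` in that degree, where `T` is already `d - 1`.
  have e1 := hadd b
  by_contra hne
  rcases lt_or_gt_of_ne hne with hlt | hlt
  · omega
  · have e2 := hadd (d + k - 1)
    have e3 := h3 (d + k - 1) (by omega) hlt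
    omega

end HilbertFunction

/-! ### Number of Jordan blocks as the dimension of a cokernel. -/

section Cokernel

/-- The image is spanned by the boxes outside column `0`, so the cokernel has one dimension for each
row. -/
theorem finrank_quotient_range_of_isJordanType {K V : Type*} [Field K] [AddCommGroup V]
    [Module K V] {φ : V →ₗ[K] V} {P : YoungDiagram} (h : IsJordanType φ P) :
    Module.finrank K (V ⧸ LinearMap.range φ) = numParts P := by
  obtain ⟨b, hb⟩ := h
  have := Module.Finite.of_basis b
  have hrange : LinearMap.range φ = Submodule.span K (b '' {c | c.1.2 ≠ 0}) := by
    rw [LinearMap.range_eq_map, ← b.span_eq, Submodule.map_span]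
    apply le_antisymm
    · rw [Submodule.span_le]
      rintro _ ⟨_, ⟨⟨⟨r, c⟩, hc⟩, rfl⟩, rfl⟩
      rw [hb]
      split_ifs with h'
      · exact Submodule.subset_span ⟨_, Nat.succ_ne_zero c, rfl⟩
      · exact Submodule.zero_mem _
    · apply Submodule.span_mono
      rintro _ ⟨⟨⟨r, c⟩, hc⟩, hc0, rfl⟩
      obtain ⟨c, rfl⟩ := Nat.exists_eq_succ_of_ne_zero hc0
      have hc' : (r, c) ∈ P.cells := P.up_left_mem le_rfl (Nat.le_succ c) hc
      exact ⟨_, ⟨⟨_, hc'⟩, rfl⟩, by rw [hb, dif_pos hc]⟩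
  have h1 := (LinearMap.range φ).finrank_quotient_add_finrank
  rw [hrange, Set.image_eq_range] at h1 ⊢
  have h2 : Module.finrank K (Submodule.span K
      (Set.range fun c : {c : {c // c ∈ P.cells} | c.1.2 ≠ 0} => b c.1)) =
      (P.cells.filter fun c => c.2 ≠ 0).card := by
    refine (finrank_span_eq_card (b.linearIndependent.comp _ Subtype.val_injective)).trans ?_
    rw [← Nat.card_eq_fintype_card, ← Nat.card_eq_finsetCard]
    refine Nat.card_congr ⟨fun c => ⟨c.1.1, ?_⟩, fun c => ⟨⟨c.1, ?_⟩, ?_⟩, fun _ => rfl,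
      fun _ => rfl⟩
    · exact Finset.mem_filter.mpr ⟨c.1.2, c.2⟩
    · exact (Finset.mem_filter.mp c.2).1
    · exact (Finset.mem_filter.mp c.2).2
  have h3 := Finset.card_filter_add_card_filter_not (s := P.cells) (fun c => c.2 = 0)
  have h4 : numParts P = (P.cells.filter fun c => c.2 = 0).card := by
    rw [numParts_eq_colLen, YoungDiagram.colLen_eq_card]; rfl
  rw [h2, Module.finrank_eq_card_basis b, Fintype.card_coe, ← h3, ← h4] at h1
  exact Nat.add_right_cancel h1

end Cokernel

/-! ### Restriction to the line where the linear form vanishes. -/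

section LineRestriction

open MvPolynomial

variable {K : Type*} [Field K]

/-- The restriction of polynomials to the line `α x + β y = 0`. -/
noncomputable def restrictLine (α β : K) : MvPolynomial (Fin 2) K →ₐ[K] Polynomial K :=
  aeval ![Polynomial.C β * Polynomial.X, Polynomial.C (-α) * Polynomial.X]

theorem restrictLine_of_isHomogeneous (α β : K) {f : MvPolynomial (Fin 2) K} {a : ℕ}
    (hf : f.IsHomogeneous a) :
    ∃ u : K, restrictLine α β f = Polynomial.C u * Polynomial.X ^ a := by
  refine ⟨∑ m ∈ f.support, coeff m f * (β ^ m 0 * (-α) ^ m 1), ?_⟩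
  rw [restrictLine, aeval_def, eval₂_eq', map_sum, Finset.sum_mul]
  refine Finset.sum_congr rfl fun m hm => ?_
  have hdeg : m 0 + m 1 = a := by
    by_contra hne
    refine (mem_support_iff.mp hm) (hf.coeff_eq_zero ?_)
    rwa [Finsupp.degree_eq_sum, Fin.sum_univ_two]
  rw [Fin.prod_univ_two, ← hdeg]
  simp only [Matrix.cons_val_zero, Matrix.cons_val_one, Polynomial.algebraMap_eq, map_mul,
    map_pow, mul_pow]
  ring

theorem exists_restrictLine_section {α β : K} (h : α ≠ 0 ∨ β ≠ 0) :
    ∃ ψ : Polynomial K →ₐ[K] MvPolynomial (Fin 2) K,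
      (∀ t, restrictLine α β (ψ t) = t) ∧
      ∀ q, q - ψ (restrictLine α β q) ∈ Ideal.span {C α * X 0 + C β * X 1} := by
  -- The section sends `t` to `γ x + δ y`, which restricts to `(γ β - δ α) t`.
  obtain ⟨γ, δ, hγδ⟩ : ∃ γ δ : K, γ * β - δ * α = 1 := by
    rcases h with h | h
    · exact ⟨0, -α⁻¹, by field_simp; ring⟩
    · exact ⟨β⁻¹, 0, by field_simp; ring⟩
  have hC : (C γ * C β - C δ * C α : MvPolynomial (Fin 2) K) = 1 := by
    rw [← C_mul, ← C_mul, ← C_sub, hγδ, C_1]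
  refine ⟨Polynomial.aeval (C γ * X 0 + C δ * X 1), ?_, ?_⟩
  · intro t
    have : (restrictLine α β).comp (Polynomial.aeval (C γ * X 0 + C δ * X 1)) =
        AlgHom.id K (Polynomial K) := by
      ext1
      have hP : (Polynomial.C γ * Polynomial.C β - Polynomial.C δ * Polynomial.C α) =
          (1 : Polynomial K) := by
        rw [← Polynomial.C_mul, ← Polynomial.C_mul, ← Polynomial.C_sub, hγδ, Polynomial.C_1]
      simp [restrictLine]
      linear_combination Polynomial.X * hP
    exact DFunLike.congr_fun this t
  · intro q
    set L : MvPolynomial (Fin 2) K := C α * X 0 + C β * X 1 with hL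
    have : ((Ideal.Quotient.mkₐ K (Ideal.span {L})).comp
        (Polynomial.aeval (C γ * X 0 + C δ * X 1))).comp (restrictLine α β) =
        Ideal.Quotient.mkₐ K (Ideal.span {L}) := by
      ext i
      simp only [AlgHom.comp_apply, Ideal.Quotient.mkₐ_eq_mk]
      rw [Ideal.Quotient.eq, Ideal.mem_span_singleton]
      fin_cases i
      · refine ⟨C δ, ?_⟩
        simp [restrictLine, hL]
        linear_combination (X 0) * hC
      · refine ⟨-C γ, ?_⟩
        simp [restrictLine, hL]
        linear_combination (X 1) * hC
    rw [← Ideal.Quotient.eq]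
    exact (DFunLike.congr_fun this q).symm

/-- Both sides are `K[x,y]/(I + (ℓ))`: the section shows that a polynomial restricting to `0` is a
multiple of `ℓ`. -/
theorem finrank_quotient_range_mulLeft {α β : K} (h : α ≠ 0 ∨ β ≠ 0)
    (I : Ideal (MvPolynomial (Fin 2) K)) :
    Module.finrank K ((MvPolynomial (Fin 2) K ⧸ I) ⧸
      LinearMap.range (LinearMap.mulLeft K (Ideal.Quotient.mk I (C α * X 0 + C β * X 1)))) =
    Module.finrank K (Polynomial K ⧸ I.map (restrictLine α β)) := by
  obtain ⟨ψ, hψ, hker⟩ := exists_restrictLine_section h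
  have hsurj : Function.Surjective (restrictLine α β) := fun t => ⟨ψ t, hψ t⟩
  set L : MvPolynomial (Fin 2) K := C α * X 0 + C β * X 1 with hL
  set N := LinearMap.range (LinearMap.mulLeft K (Ideal.Quotient.mk I L)) with hN
  let π : MvPolynomial (Fin 2) K →ₗ[K] (MvPolynomial (Fin 2) K ⧸ I) ⧸ N :=
    N.mkQ ∘ₗ (Ideal.Quotient.mkₐ K I).toLinearMap
  let ρ : MvPolynomial (Fin 2) K →ₗ[K] Polynomial K ⧸ I.map (restrictLine α β) :=
    ((Ideal.Quotient.mkₐ K (I.map (restrictLine α β))).comp (restrictLine α β)).toLinearMap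
  have hπ : Function.Surjective π :=
    N.mkQ_surjective.comp (Ideal.Quotient.mkₐ_surjective K I)
  have hρ : Function.Surjective ρ :=
    (Ideal.Quotient.mkₐ_surjective K (I.map (restrictLine α β))).comp hsurj
  have hL0 : restrictLine α β L = 0 := by
    simp [restrictLine, hL]; ring
  have hkers : LinearMap.ker π = LinearMap.ker ρ := by
    ext q
    have e1 : q ∈ LinearMap.ker π ↔ ∃ w, q - L * w ∈ I := by
      rw [LinearMap.mem_ker]
      change N.mkQ (Ideal.Quotient.mk I q) = 0 ↔ _
      rw [Submodule.mkQ_apply, Submodule.Quotient.mk_eq_zero, hN, LinearMap.mem_range]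
      constructor
      · rintro ⟨w, hw⟩
        obtain ⟨w, rfl⟩ := Ideal.Quotient.mk_surjective w
        refine ⟨w, ?_⟩
        rw [← Ideal.Quotient.eq, map_mul]
        exact hw.symm
      · rintro ⟨w, hw⟩
        refine ⟨Ideal.Quotient.mk I w, ?_⟩
        rw [← Ideal.Quotient.eq, map_mul] at hw
        exact hw.symm
    have e2 : q ∈ LinearMap.ker ρ ↔ restrictLine α β q ∈ I.map (restrictLine α β) := by
      rw [LinearMap.mem_ker]
      exact Ideal.Quotient.eq_zero_iff_mem
    rw [e1, e2, Ideal.mem_map_iff_of_surjective _ hsurj]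
    constructor
    · rintro ⟨w, hw⟩
      exact ⟨_, hw, by rw [map_sub, map_mul, hL0, zero_mul, sub_zero]⟩
    · rintro ⟨q', hq', he⟩
      have h1 := hker (q - q')
      rw [map_sub, he, sub_self, map_zero, sub_zero] at h1
      obtain ⟨w, hw⟩ := Ideal.mem_span_singleton.mp h1
      exact ⟨w, by rw [← hw, sub_sub_cancel]; exact hq'⟩
  rw [← (π.quotKerEquivOfSurjective hπ).finrank_eq, ← (ρ.quotKerEquivOfSurjective hρ).finrank_eq,
    hkers]

/-- If `u ≠ 0` the second monomial is redundant; otherwise only the second remains. The value `0`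
covers `u = v = 0`, where the quotient is infinite-dimensional and `finrank` takes its default
value. -/
theorem finrank_quotient_span_monomials {a b : ℕ} (hab : a ≤ b) (u v : K) :
    Module.finrank K (Polynomial K ⧸ Ideal.span
      {Polynomial.C u * Polynomial.X ^ a, Polynomial.C v * Polynomial.X ^ b}) ∈
      ({0, a, b} : Set ℕ) := by
  by_cases hu : u = 0
  · rw [hu, map_zero, zero_mul, Ideal.span_insert_zero, finrank_quotient_span_eq_natDegree]
    by_cases hv : v = 0
    · simp [hv]
    · simp [Polynomial.natDegree_C_mul_X_pow b v hv]
  · have : Ideal.span {Polynomial.C u * Polynomial.X ^ a, Polynomial.C v * Polynomial.X ^ b} =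
        Ideal.span {Polynomial.C u * Polynomial.X ^ a} := by
      refine le_antisymm ?_ (Ideal.span_mono (by simp))
      rw [Ideal.span_le]
      rintro _ (rfl | rfl)
      · exact Ideal.subset_span rfl
      · refine Ideal.mem_span_singleton.mpr ⟨Polynomial.C (u⁻¹ * v) * Polynomial.X ^ (b - a), ?_⟩
        have hC : Polynomial.C u * Polynomial.C (u⁻¹ * v) = Polynomial.C v := by
          rw [← Polynomial.C_mul, mul_inv_cancel_left₀ hu]
        rw [← hC]
        nth_rewrite 1 [← Nat.add_sub_cancel' hab]
        ring
    rw [this, finrank_quotient_span_eq_natDegree, Polynomial.natDegree_C_mul_X_pow a u hu]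
    simp

end LineRestriction

/-! ### The number of parts of a complete intersection Jordan type. -/

section Main

open MvPolynomial

variable {K : Type*} [Field K]

theorem numParts_of_ordered_generators {d k a b : ℕ} (hd : 2 ≤ d) (hk : 1 ≤ k)
    {f g : MvPolynomial (Fin 2) K} (hf : f.IsHomogeneous a) (hg : g.IsHomogeneous b)
    (hab : a ≤ b) (hf0 : f ≠ 0) (hfg : ¬ f ∣ g)
    (hT : ∀ i, hilbertFunction (Ideal.span {f, g}) i = ciHilbertFunction d k i)
    {α β : K} (hαβ : α ≠ 0 ∨ β ≠ 0) {P : YoungDiagram} (hpos : 0 < numParts P)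
    (hP : IsJordanType (LinearMap.mulLeft K
      (Ideal.Quotient.mk (Ideal.span {f, g}) (C α * X 0 + C β * X 1))) P) :
    numParts P = d ∨ numParts P = d + k - 1 := by
  obtain ⟨rfl, rfl⟩ := degrees_eq_of_hilbertFunction hd hk hf hg hab hf0 hfg hT
  obtain ⟨u, hu⟩ := restrictLine_of_isHomogeneous α β hf
  obtain ⟨v, hv⟩ := restrictLine_of_isHomogeneous α β hg
  have h := finrank_quotient_range_of_isJordanType hP
  rw [finrank_quotient_range_mulLeft hαβ, Ideal.map_span, Set.image_pair, hu, hv] at h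
  have h' := finrank_quotient_span_monomials hab u v
  rw [h] at h'
  rcases h' with h' | h' | h'
  · omega
  · exact Or.inl h'
  · exact Or.inr h'

theorem not_dvd_of_isRegular {R : Type*} [CommRing R] [IsDomain R] {f g : R}
    (h : RingTheory.Sequence.IsRegular R [f, g]) : f ≠ 0 ∧ g ≠ 0 ∧ ¬ f ∣ g ∧ ¬ g ∣ f := by
  obtain ⟨h0, h1, h2⟩ := (isRegular_pair_iff f g).mp h
  have hfu : ¬ IsUnit f := fun hu => h2 (Ideal.eq_top_of_isUnit_mem _ (Ideal.subset_span
    (by simp)) hu)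
  have hgu : ¬ IsUnit g := fun hu => h2 (Ideal.eq_top_of_isUnit_mem _ (Ideal.subset_span
    (by simp)) hu)
  have hfg : ¬ f ∣ g := fun hd => hfu (isUnit_of_dvd_one (h1 1 (by rwa [mul_one])))
  refine ⟨h0, fun hg => hfg (hg ▸ dvd_zero f), hfg, ?_⟩
  rintro ⟨u, hu⟩
  obtain ⟨w, rfl⟩ := h1 u (hu ▸ dvd_rfl)
  refine hgu (isUnit_of_dvd_one ⟨w, mul_left_cancel₀ h0 ?_⟩)
  rw [mul_one, mul_left_comm]
  exact hu

theorem numParts_of_isCIJordanType {d k : ℕ} (hd : 2 ≤ d) (hk : 1 ≤ k) {P : YoungDiagram}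
    (hP : ∀ i, diagonalLength P i = ciHilbertFunction d k i)
    (h : IsCIJordanType K (ciHilbertFunction d k) P) :
    numParts P = d ∨ numParts P = d + k - 1 := by
  obtain ⟨I, ⟨-, f, g, a, b, hf, hg, hreg, rfl⟩, hT, l, hl, hJ⟩ := h
  obtain ⟨hf0, hg0, hfg, hgf⟩ := not_dvd_of_isRegular hreg
  -- Since `T_1 = 2`, both boxes of diagonal `1` are present. Box `(0, 1)` makes the action nonzero,
  -- hence `ℓ ≠ 0`.
  have hrow : 1 < P.rowLen 0 := by
    have h1 := hP 1
    rw [diagonalLength_eq_card_rows] at h1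
    have h2 : ciHilbertFunction d k 1 = 2 := by unfold ciHilbertFunction; omega
    rw [h2] at h1
    by_contra hle
    have : ((Finset.range (1 + 1)).filter fun r => 1 < r + P.rowLen r) ⊆ {1} := by
      intro r hr
      simp only [Finset.mem_filter, Finset.mem_range] at hr
      have : r ≠ 0 := by rintro rfl; omega
      simp only [Finset.mem_singleton]
      omega
    have := Finset.card_le_card this
    rw [h1] at this
    simp at this
  have hpos : 0 < numParts P := (rowLen_pos_iff P 0).mp (by omega)
  obtain ⟨α, β, rfl⟩ : ∃ α β : K, l = C α * X 0 + C β * X 1 := by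
    have : l ∈ homogeneousSubmodule (Fin 2) K 1 := hl
    rw [homogeneousSubmodule_one_eq_span_X, Submodule.mem_span_range_iff_exists_fun] at this
    obtain ⟨c, rfl⟩ := this
    exact ⟨c 0, c 1, by simp [Fin.sum_univ_two, C_mul']⟩
  have hαβ : α ≠ 0 ∨ β ≠ 0 := by
    by_contra! h0
    obtain ⟨rfl, rfl⟩ := h0
    obtain ⟨bas, hb⟩ := hJ
    have h00 : (0, 0) ∈ P.cells := YoungDiagram.mem_iff_lt_rowLen.mpr (by omega)
    have h01 : (0, 0 + 1) ∈ P.cells := YoungDiagram.mem_iff_lt_rowLen.mpr (by omega)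
    have := hb 0 0 h00
    rw [dif_pos h01] at this
    exact bas.ne_zero _ (this.symm.trans (by simp))
  rcases le_total a b with hab | hab
  · exact numParts_of_ordered_generators hd hk hf hg hab hf0 hfg hT hαβ hpos hJ
  · rw [Ideal.span_pair_comm] at hT
    have e : Ideal.span {f, g} = Ideal.span {g, f} := Ideal.span_pair_comm
    refine numParts_of_ordered_generators hd hk hg hf hab hg0 hgf hT hαβ hpos ?_
    exact e ▸ hJ

end Main

theorem theorem3p8 {K : Type*} [Field K] [Infinite K] (d k : ℕ) (hd : 2 ≤ d) (hk : 1 ≤ k)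
    (hchar : ringChar K = 0 ∨ 2 * d + k - 3 < ringChar K)
    (P : YoungDiagram) (hP : ∀ i, diagonalLength P i = ciHilbertFunction d k i) :
    IsCIJordanType K (ciHilbertFunction d k) P ↔ numParts P = d ∨ numParts P = d + k - 1 := by
  refine ⟨numParts_of_isCIJordanType hd hk hP, fun hn => ?_⟩
  rw [← funext hP]
  exact exists_ci_of_rowsEndOnce (rowsEndOnceFrom_of_diagonalLength hd hk hP hn) (by omega)
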